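/- Let $E$ be a finite-dimensional complex Lie algebra with Killing form $\kappa$. A real subspace $W\subset E$ is a real form of $E$ if $E=W\oplus iW$; its conjugation map is $x+iy\mapsto x-iy$ ($x,y\in W$). Two real forms are compatible if their conjugation maps commute. A real slice of $(E,-\kappa)$ is a real subspace on which $-\kappa$ is real valued and nondegenerate. Let $\mathfrak g,\tilde{\mathfrak g},\mathfrak u\subset E$ be real Lie subalgebras with $\mathfrak g,\tilde{\mathfrak g}$ semisimple, such that $(\mathfrak g,\tilde{\mathfrak g},\mathfrak u)$ is a compatible triple: all three are real forms of $E$ and real slices of $(E,-\kappa)$, they are pairwise compatible, and $-\kappa$ is positive definite on $\mathfrak u$. Let $\mathfrak g=\mathfrak t\oplus\mathfrak p$ and $\tilde{\mathfrak g}=\tilde{\mathfrak t}\oplus\tilde{\mathfrak p}$ be the Cartan decompositions (the $\pm1$-eigenspace decompositions of Cartan involutions of $\mathfrak g$ and $\tilde{\mathfrak g}$) determined by $\mathfrak u$, i.e. those with $\mathfrak u=\mathfrak t\oplus i\mathfrak p=\tilde{\mathfrak t}\oplus i\tilde{\mathfrak p}$. Assume that $\mathfrak g\not\cong\tilde{\mathfrak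 g}$ as real Lie algebras. Then $$\mathfrak t\cap\tilde{\mathfrak t}\neq0 .$$ If moreover $\mathfrak g$ and $\tilde{\mathfrak g}$ are both simple (as real Lie algebras) and neither is compact (i.e. neither has negative definite Killing form), then also $$\mathfrak p\cap\tilde{\mathfrak p}\neq0 .$$ -/

import Mathlib

/-- A complex Lie algebra, regarded as a real Lie algebra by restriction of scalars. -/
instance LieAlgebra.complexToReal {E : Type*} [LieRing E] [LieAlgebra ℂ E] :
    LieAlgebra ℝ E where
  lie_smul r x y := by
    rw [← Complex.coe_smul, ← Complex.coe_smul, lie_smul]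

namespace CompatibleTriple

section Vector

variable {E : Type*} [AddCommGroup E] [Module ℂ E]

/-- The complex structure of `E`, i.e. multiplication by `i`, as a real linear map. -/
noncomputable def J (E : Type*) [AddCommGroup E] [Module ℂ E] : E →ₗ[ℝ] E :=
  (Complex.I • (LinearMap.id : E →ₗ[ℂ] E)).restrictScalars ℝ

/-- The real subspace `i W` of `E`. -/
noncomputable def iMul (W : Submodule ℝ E) : Submodule ℝ E := W.map (J E)

/-- `W` is a real form of `E`: `E = W ⊕ i W`, so that `E` is the complexification of `W`. -/
def IsRealForm (W : Submodule ℝ E) : Prop := IsCompl W (iMul W)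

/-- The conjugation map of a real form: `x + i y ↦ x - i y` for `x, y ∈ W`. -/
noncomputable def conj {W : Submodule ℝ E} (hW : IsRealForm W) : E →ₗ[ℝ] E :=
  LinearMap.ofIsCompl hW W.subtype (-(iMul W).subtype)

/-- Two real forms are compatible if their conjugation maps commute. -/
def Compatible {W W' : Submodule ℝ E} (hW : IsRealForm W) (hW' : IsRealForm W') : Prop :=
  conj hW ∘ₗ conj hW' = conj hW' ∘ₗ conj hW

/-- A real slice of `(E, B)`: a real subspace on which the complex bilinear form `B` is real valued
and nondegenerate. -/
structure IsRealSlice (B : LinearMap.BilinForm ℂ E) (W : Submodule ℝ E) : Prop where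
  real_valued : ∀ x ∈ W, ∀ y ∈ W, (B x y).im = 0
  nondegenerate : ∀ x ∈ W, (∀ y ∈ W, B x y = 0) → x = 0

/-- `(W, W', V)` is a compatible triple in `(E, B)`: all three are real slices and real forms of
`E`, pairwise compatible, and `V` has Euclidean signature. -/
structure IsCompatibleTriple (B : LinearMap.BilinForm ℂ E) (W W' V : Submodule ℝ E) : Prop where
  slice_left : IsRealSlice B W
  slice_right : IsRealSlice B W'
  slice_compact : IsRealSlice B V
  form_left : IsRealForm W
  form_right : IsRealForm W'
  form_compact : IsRealForm V
  euclidean : ∀ x ∈ V, x ≠ 0 → 0 < (B x x).re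
  compatible_left_right : Compatible form_left form_right
  compatible_left_compact : Compatible form_left form_compact
  compatible_right_compact : Compatible form_right form_compact

end Vector

section RealLie

variable {L : Type*} [LieRing L] [LieAlgebra ℝ L]

/-- A (semisimple) real Lie algebra is compact if its Killing form is negative definite. -/
def IsCompactLie (L : Type*) [LieRing L] [LieAlgebra ℝ L] : Prop :=
  ∀ x : L, x ≠ 0 → killingForm ℝ L x x < 0

/-- A Cartan involution of a real Lie algebra with Killing form `κ`: an involutive automorphism `θ`
such that `(x, y) ↦ -κ(x, θ y)` is positive definite. -/
structure IsCartanInvolution (θ : L ≃ₗ⁅ℝ⁆ L) : Prop where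
  involutive : ∀ x, θ (θ x) = x
  pos : ∀ x, x ≠ 0 → 0 < -killingForm ℝ L x (θ x)

end RealLie

section ComplexLie

variable {E : Type*} [LieRing E] [LieAlgebra ℂ E]

/-- The compact part `𝔱` (the `+1`-eigenspace of `θ`) of the Cartan decomposition `𝔤 = 𝔱 ⊕ 𝔭`,
as a subspace of the ambient complex Lie algebra. -/
noncomputable def compactPart {g : LieSubalgebra ℝ E} (θ : g ≃ₗ⁅ℝ⁆ g) : Submodule ℝ E :=
  (Module.End.eigenspace (θ : g →ₗ[ℝ] g) 1).map g.toSubmodule.subtype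

/-- The noncompact part `𝔭` (the `-1`-eigenspace of `θ`) of the Cartan decomposition
`𝔤 = 𝔱 ⊕ 𝔭`, as a subspace of the ambient complex Lie algebra. -/
noncomputable def noncompactPart {g : LieSubalgebra ℝ E} (θ : g ≃ₗ⁅ℝ⁆ g) : Submodule ℝ E :=
  (Module.End.eigenspace (θ : g →ₗ[ℝ] g) (-1)).map g.toSubmodule.subtype

/-- The Cartan involution `θ` of `𝔤` belongs to the compact form `𝔲`: one has `𝔲 = 𝔱 ⊕ i 𝔭`
(the sum is direct as soon as `𝔤` is a real form). -/
def IsAdapted (u : LieSubalgebra ℝ E) {g : LieSubalgebra ℝ E} (θ : g ≃ₗ⁅ℝ⁆ g) : Prop :=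
  compactPart θ ⊔ iMul (noncompactPart θ) = u.toSubmodule

end ComplexLie

end CompatibleTriple

/-! The commuting conjugations σ, σ' of 𝔤, 𝔤̃ preserve 𝔲, so their joint signs grade it by the Klein
four-group: 𝔲 = O ⊕ A ⊕ B ⊕ C with signs (1,1), (1,-1), (-1,1), (-1,-1). Here O = 𝔱 ∩ 𝔱̃ and C = i(𝔭
∩ 𝔭̃).

If O = 0, then A, B, C are abelian and the bracket of any two lies in the third. Some W ∈ C has (ad
W)² = -1 on A ⊕ B (`exists_lie_lie_eq_neg`), so exp((π/2) ad W) swaps A with B and fixes C. It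
therefore carries σ to σ' (`exists_lieEquiv_intertwining`) and 𝔤 onto 𝔤̃, contradicting
non-isomorphism.

If C = 0, the grading forces [𝔭, 𝔭̃] = 0. For 𝔤 simple and noncompact, 𝔭 generates 𝔤
(`lieSpan_neg_eigenspace_eq_top`), so 𝔭̃ is central in E and hence zero, contradicting
noncompactness of 𝔤̃. -/

namespace CompatibleTriple

/-! ### Simultaneous diagonalization of commuting symmetric operators -/

section Diagonalization

open Module.End in
/-- A commuting family of operators on a real vector space which are symmetric with respect to a
bilinear form that is positive definite on the invariant finite-dimensional subspace `A` has an
orthogonal family of joint eigenvectors spanning `A`. -/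
theorem exists_orthogonal_joint_eigenvectors {V κ : Type*} [AddCommGroup V] [Module ℝ V]
    (A : Submodule ℝ V) [FiniteDimensional ℝ A] (Q : V →ₗ[ℝ] V →ₗ[ℝ] ℝ)
    (hsymm : ∀ x y, Q x y = Q y x) (hpos : ∀ x ∈ A, x ≠ 0 → 0 < Q x x)
    (T : κ → V →ₗ[ℝ] V) (hTA : ∀ k, ∀ x ∈ A, T k x ∈ A)
    (hT : ∀ k, ∀ x ∈ A, ∀ y ∈ A, Q (T k x) y = Q x (T k y))
    (hcomm : ∀ k l, ∀ x ∈ A, T k (T l x) = T l (T k x)) :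
    ∃ (n : ℕ) (v : Fin n → V), (∀ i, v i ∈ A) ∧ (∀ i, v i ≠ 0) ∧
      (∀ i j, i ≠ j → Q (v i) (v j) = 0) ∧ (∀ k i, ∃ μ : ℝ, T k (v i) = μ • v i) ∧
      Submodule.span ℝ (Set.range v) = A := by
  classical
  let core : InnerProductSpace.Core ℝ A :=
    { inner := fun x y => Q x y
      conj_inner_symm := fun x y => by simpa using hsymm _ _
      re_inner_nonneg := fun x => by
        by_cases h : x = 0
        · simp [h]
        · simpa using (hpos x x.2 (by simpa using h)).le
      add_left := fun x y z => by simp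
      smul_left := fun x y r => by simp
      definite := fun x h => by
        by_contra h0
        exact (hpos x x.2 (by simpa using h0)).ne' h }
  let _ : NormedAddCommGroup A := core.toNormedAddCommGroup
  let _ : InnerProductSpace ℝ A := InnerProductSpace.ofCore core.toCore
  have hinner : ∀ x y : A, inner ℝ x y = Q x y := fun x y => rfl
  let S : κ → A →ₗ[ℝ] A := fun k => (T k).restrict (hTA k)
  have hS : ∀ k, (S k).IsSymmetric := fun k x y => hT k x x.2 y y.2
  have hC : Pairwise (Function.onFun Commute S) := fun k l _ => by
    refine LinearMap.ext fun x => Subtype.ext ?_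
    exact hcomm k l x x.2
  let F : (κ → ℝ) → Submodule ℝ A := fun χ => ⨅ k, eigenspace (S k) (χ k)
  have hF : OrthogonalFamily ℝ (fun χ => F χ) fun χ => (F χ).subtypeₗᵢ :=
    LinearMap.IsSymmetric.orthogonalFamily_iInf_eigenspaces hS
  have htop : ⨆ χ, F χ = ⊤ := LinearMap.IsSymmetric.iSup_iInf_eq_top_of_commute hS hC
  -- Only finitely many joint eigenvalue systems χ occur; discarding the others gives the finite
  -- index set an orthonormal basis needs.
  have hfin : Finite {χ // F χ ≠ ⊥} :=
    WellFoundedGT.finite_ne_bot_of_iSupIndep hF.independent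
  let _ : Fintype {χ // F χ ≠ ⊥} := Fintype.ofFinite _
  have hF' : OrthogonalFamily ℝ (fun χ : {χ // F χ ≠ ⊥} => F χ) fun χ => (F χ).subtypeₗᵢ :=
    hF.comp Subtype.val_injective
  have hint : DirectSum.IsInternal (fun χ : {χ // F χ ≠ ⊥} => F χ) := by
    rw [hF'.isInternal_iff, iSup_ne_bot_subtype, htop, Submodule.top_orthogonal_eq_bot]
  let b := hint.subordinateOrthonormalBasis rfl hF'
  refine ⟨_, fun i => (b i : V), fun i => (b i).2, fun i h => ?_, fun i j hij => ?_,
    fun k i => ?_, ?_⟩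
  · exact b.orthonormal.ne_zero i (Subtype.ext h)
  · rw [← hinner]
    exact b.orthonormal.2 hij
  · have h := hint.subordinateOrthonormalBasis_subordinate rfl i hF'
    have h' := (Submodule.mem_iInf _).1 h k
    rw [mem_eigenspace_iff] at h'
    exact ⟨_, congrArg Subtype.val h'⟩
  · have h : Submodule.span ℝ (Set.range b) = ⊤ := by
      rw [← b.coe_toBasis]; exact b.toBasis.span_eq
    have h2 := congrArg (Submodule.map A.subtype) h
    rw [Submodule.map_span, Submodule.map_top, Submodule.range_subtype, ← Set.range_comp] at h2
    exact h2

end Diagonalization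

/-! ### The quarter-turn automorphism -/

section Rotation

variable {L : Type*} [LieRing L] [LieAlgebra ℝ L]

/-- Let `A`, `B`, `C` be the pieces of a compact Lie algebra graded by the Klein four-group with
trivial neutral component. If `C` acts faithfully, then some `W ∈ C` satisfies `(ad W) ^ 2 = -1`
on `A`. -/
theorem exists_lie_lie_eq_neg (Q : L →ₗ[ℝ] L →ₗ[ℝ] ℝ) (hsymm : ∀ x y, Q x y = Q y x)
    (hinv : ∀ x y z, Q ⁅x, y⁆ z = Q x ⁅y, z⁆) (A B C : Submodule ℝ L) [FiniteDimensional ℝ A]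
    (hA : ∀ x ∈ A, x ≠ 0 → 0 < Q x x) (hC : ∀ x ∈ C, x ≠ 0 → 0 < Q x x)
    (hB : ∀ x ∈ B, x ≠ 0 → 0 < Q x x)
    (hAA : ∀ x ∈ A, ∀ y ∈ A, ⁅x, y⁆ = 0) (hCC : ∀ x ∈ C, ∀ y ∈ C, ⁅x, y⁆ = 0)
    (hCA : ∀ x ∈ C, ∀ y ∈ A, ⁅x, y⁆ ∈ B) (hAB : ∀ x ∈ A, ∀ y ∈ B, ⁅x, y⁆ ∈ C)
    (hCB : ∀ x ∈ C, ∀ y ∈ B, ⁅x, y⁆ ∈ A)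
    (hfaith : ∀ x ∈ A, (∀ y ∈ C, ⁅y, x⁆ = 0) → x = 0) :
    ∃ W ∈ C, ∀ x ∈ A, ⁅W, ⁅W, x⁆⁆ = -x := by
  classical
  have hskew : ∀ x y z : L, Q ⁅x, y⁆ z = -Q y ⁅x, z⁆ := fun x y z => by
    rw [← lie_skew x y, map_neg, LinearMap.neg_apply, hinv]
  have hswap : ∀ x ∈ C, ∀ y ∈ C, ∀ z : L, ⁅x, ⁅y, z⁆⁆ = ⁅y, ⁅x, z⁆⁆ := fun x hx y hy z => by
    rw [leibniz_lie, hCC x hx y hy, zero_lie, zero_add]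
  -- A single ad y with y ∈ C sends A to B, so products ad y ∘ ad z are diagonalized instead: they
  -- preserve A, and are symmetric since the factors are skew and commute.
  obtain ⟨n, v, hvA, hv0, hvo, heig, hspan⟩ := exists_orthogonal_joint_eigenvectors A Q hsymm hA
    (fun k : C × C => LieAlgebra.ad ℝ L k.1 ∘ₗ LieAlgebra.ad ℝ L k.2)
    (fun k x hx => hCB _ k.1.2 _ (hCA _ k.2.2 _ hx))
    (fun k x hx y hy => by
      simp only [LinearMap.comp_apply, LieAlgebra.ad_apply]
      rw [hskew, hskew, neg_neg, hswap _ k.1.2 _ k.2.2])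
    (fun k l x hx => by
      simp only [LinearMap.comp_apply, LieAlgebra.ad_apply]
      rw [hswap _ k.2.2 _ l.1.2, hswap _ k.1.2 _ l.1.2, hswap _ k.2.2 _ l.2.2,
        hswap _ k.1.2 _ l.2.2])
  have heig' : ∀ y ∈ C, ∀ z ∈ C, ∀ i, ∃ μ : ℝ, ⁅y, ⁅z, v i⁆⁆ = μ • v i :=
    fun y hy z hz i => heig (⟨y, hy⟩, ⟨z, hz⟩) i
  have hx : ∀ i, ∃ x ∈ C, ⁅x, v i⁆ ≠ 0 := fun i => by
    by_contra! h
    exact hv0 i (hfaith _ (hvA i) h)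
  choose x hxC hx0 using hx
  let h : Fin n → L := fun i => ⁅v i, ⁅x i, v i⁆⁆
  have hhC : ∀ i, h i ∈ C := fun i => hAB _ (hvA i) _ (hCA _ (hxC i) _ (hvA i))
  -- For m = [v i, [x j, v j]] ∈ C, invariance turns Q(m, m) into a multiple of Q(v i, v j) = 0, so
  -- m = 0; Jacobi and [A, A] = 0 then give the claim.
  have hoff : ∀ i j, i ≠ j → ⁅h j, v i⁆ = 0 := fun i j hij => by
    have hz : ⁅v i, ⁅x j, v j⁆⁆ = 0 := by
      have hmem := hAB _ (hvA i) _ (hCA _ (hxC j) _ (hvA j))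
      by_contra hne
      have hp := hC _ hmem hne
      obtain ⟨μ, hμ⟩ := heig' _ hmem _ (hxC j) j
      rw [hinv, ← lie_skew, hμ, map_neg, map_smul, hvo i j hij] at hp
      simp at hp
    rw [← lie_skew]
    change -⁅v i, ⁅v j, ⁅x j, v j⁆⁆⁆ = 0
    rw [leibniz_lie, hAA _ (hvA i) _ (hvA j), zero_lie, hz, lie_zero, add_zero, neg_zero]
  -- Otherwise Q(h i, h i) = 0, so h i = 0, and then Q([x i, v i], [x i, v i]) = Q(h i, x i) = 0,
  -- against the choice of x i.
  have hon : ∀ i, ⁅h i, v i⁆ ≠ 0 := fun i h0 => by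
    have e1 : Q (h i) (h i) = 0 := by
      change Q ⁅v i, ⁅x i, v i⁆⁆ (h i) = 0
      rw [hinv, ← lie_skew, hswap _ (hhC i) _ (hxC i), h0]
      simp
    have e2 : h i = 0 := by
      by_contra hne
      exact (hC _ (hhC i) hne).ne' e1
    have e3 : Q ⁅x i, v i⁆ ⁅x i, v i⁆ = Q (h i) (x i) := by
      change _ = Q ⁅v i, ⁅x i, v i⁆⁆ (x i)
      rw [hskew, hinv, ← lie_skew _ (x i), map_neg]
    rw [e2, map_zero, LinearMap.zero_apply] at e3
    exact (hB _ (hCA _ (hxC i) _ (hvA i)) (hx0 i)).ne' e3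
  have hs : ∀ i, ∃ s : ℝ, 0 < s ∧ ⁅h i, ⁅h i, v i⁆⁆ = -s • v i := fun i => by
    obtain ⟨μ, hμ⟩ := heig' _ (hhC i) _ (hhC i) i
    refine ⟨-μ, ?_, by rw [hμ, neg_neg]⟩
    have hp := hB _ (hCA _ (hhC i) _ (hvA i)) (hon i)
    rw [hskew, hμ, map_smul, smul_eq_mul] at hp
    have := hA _ (hvA i) (hv0 i)
    by_contra! hneg
    nlinarith
  choose s hs0 hs1 using hs
  -- Only h i acts on v i, with square -s i; the weights normalize every square to -1.
  let W : L := ∑ j, (√(s j))⁻¹ • h j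
  have hWC : W ∈ C := C.sum_mem fun j _ => C.smul_mem _ (hhC j)
  have hWv : ∀ i, ⁅W, v i⁆ = (√(s i))⁻¹ • ⁅h i, v i⁆ := fun i => by
    rw [sum_lie, Finset.sum_eq_single i, smul_lie]
    · intro j _ hji
      rw [smul_lie, hoff i j hji.symm, smul_zero]
    · simp
  refine ⟨W, hWC, fun a ha => ?_⟩
  rw [← hspan] at ha
  induction ha using Submodule.span_induction with
  | mem y hy =>
    obtain ⟨i, rfl⟩ := hy
    rw [hWv, lie_smul, hswap _ hWC _ (hhC i), hWv, lie_smul, hs1, smul_smul, smul_smul]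
    have : (√(s i))⁻¹ * (√(s i))⁻¹ * -s i = -1 := by
      rw [← mul_inv, Real.mul_self_sqrt (hs0 i).le, mul_neg, inv_mul_cancel₀ (hs0 i).ne']
    rw [this, neg_one_smul]
  | zero => simp
  | add y z _ _ hy hz => rw [lie_add, lie_add, hy, hz, neg_add]
  | smul r y _ hy => rw [lie_smul, lie_smul, hy, smul_neg]

/-- If a derivation `D` satisfies `D ^ 3 = -D`, then `1 + D + D ^ 2 = exp ((π / 2) D)` is a Lie
algebra automorphism. -/
theorem exists_lieEquiv_of_derivation_cube_eq_neg (D : LieDerivation ℝ L L)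
    (hD3 : ∀ x, D (D (D x)) = -D x) :
    ∃ φ : L ≃ₗ⁅ℝ⁆ L, ∀ x, φ x = x + D x + D (D x) := by
  have hD : ∀ x y, D ⁅x, y⁆ = ⁅x, D y⁆ + ⁅D x, y⁆ := fun x y => D.apply_lie_eq_add x y
  -- Expanding D³[x, y] by Leibniz and using D³ = -D leaves only three times the mixed terms, which
  -- must vanish.
  have key : ∀ x y, ⁅D (D x), D y⁆ = -⁅D x, D (D y)⁆ := fun x y => by
    have h := hD3 ⁅x, y⁆
    simp only [hD, map_add, hD3, neg_lie, lie_neg] at h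
    have h3 : (3 : ℝ) • (⁅D (D x), D y⁆ + ⁅D x, D (D y)⁆) = 0 := by
      rw [← sub_eq_zero] at h
      rw [← h]
      module
    rw [smul_eq_zero_iff_right (by norm_num)] at h3
    exact eq_neg_of_add_eq_zero_left h3
  have key2 : ∀ x y, ⁅D (D x), D (D y)⁆ = ⁅D x, D y⁆ := fun x y => by
    rw [key, hD3, lie_neg, neg_neg]
  let f : L →ₗ[ℝ] L := LinearMap.id + D.toLinearMap + D.toLinearMap ∘ₗ D.toLinearMap
  let f' : L →ₗ[ℝ] L := LinearMap.id - D.toLinearMap + D.toLinearMap ∘ₗ D.toLinearMap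
  have hf : ∀ x, f x = x + D x + D (D x) := fun x => rfl
  have hf' : ∀ x, f' x = x - D x + D (D x) := fun x => rfl
  refine ⟨{ toFun := f, map_add' := f.map_add, map_smul' := f.map_smul, map_lie' := ?_,
            invFun := f', left_inv := ?_, right_inv := ?_ }, fun x => rfl⟩
  · intro x y
    simp only [hf, hD, lie_add, add_lie, map_add, key2, key]
    abel
  · intro x
    simp only [hf, hf', map_add, hD3, map_neg]
    abel
  · intro x
    simp only [hf, hf', map_add, map_sub, hD3, map_neg]
    abel

end Rotation

/-! ### Conjugation maps of real forms -/

section RealForm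

variable {E : Type*} [AddCommGroup E] [Module ℂ E]

@[simp] theorem J_apply (x : E) : J E x = Complex.I • x := rfl

theorem J_J (x : E) : J E (J E x) = -x := by
  simp [smul_smul]

theorem J_injective : Function.Injective (J E) := fun x y h => by
  have := congrArg (J E) h
  rwa [J_J, J_J, neg_inj] at this

variable {W : Submodule ℝ E}

theorem IsRealForm.exists_eq_add (hW : IsRealForm W) (z : E) :
    ∃ x ∈ W, ∃ y ∈ W, z = x + J E y := by
  have hz : z ∈ W ⊔ iMul W := by rw [hW.sup_eq_top]; trivial
  obtain ⟨x, hx, _, ⟨y, hy, rfl⟩, h⟩ := Submodule.mem_sup.1 hz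
  exact ⟨x, hx, y, hy, h.symm⟩

theorem conj_of_mem (hW : IsRealForm W) {x : E} (hx : x ∈ W) : conj hW x = x :=
  LinearMap.ofIsCompl_apply_left hW (⟨x, hx⟩ : W)

theorem conj_J_of_mem (hW : IsRealForm W) {x : E} (hx : x ∈ W) :
    conj hW (J E x) = -J E x :=
  LinearMap.ofIsCompl_apply_right hW (⟨J E x, x, hx, rfl⟩ : iMul W)

theorem conj_conj (hW : IsRealForm W) (z : E) : conj hW (conj hW z) = z := by
  obtain ⟨x, hx, y, hy, rfl⟩ := hW.exists_eq_add z
  rw [map_add, conj_of_mem hW hx, conj_J_of_mem hW hy, map_add, map_neg, conj_of_mem hW hx,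
    conj_J_of_mem hW hy, neg_neg]

theorem conj_J (hW : IsRealForm W) (z : E) : conj hW (J E z) = -J E (conj hW z) := by
  obtain ⟨x, hx, y, hy, rfl⟩ := hW.exists_eq_add z
  rw [map_add (J E), map_add, map_add, conj_of_mem hW hx, conj_J_of_mem hW hy, J_J, map_neg,
    conj_of_mem hW hy, conj_J_of_mem hW hx, map_add, map_neg, J_J]
  abel

theorem eq_zero_of_eq_neg {x : E} (h : x = -x) : x = 0 := by
  have h2 : (2 : ℝ) • x = 0 := by
    rw [two_smul]
    nth_rewrite 1 [h]
    exact neg_add_cancel x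
  rwa [smul_eq_zero_iff_right (by norm_num)] at h2

theorem conj_eq_self_iff (hW : IsRealForm W) {z : E} : conj hW z = z ↔ z ∈ W := by
  refine ⟨fun h => ?_, conj_of_mem hW⟩
  obtain ⟨x, hx, y, hy, rfl⟩ := hW.exists_eq_add z
  rw [map_add, conj_of_mem hW hx, conj_J_of_mem hW hy, add_right_inj] at h
  rwa [eq_zero_of_eq_neg h.symm, add_zero]

theorem conj_eq_neg_iff (hW : IsRealForm W) {z : E} : conj hW z = -z ↔ J E z ∈ W := by
  rw [← conj_eq_self_iff hW, conj_J, ← map_neg, J_injective.eq_iff, neg_eq_iff_eq_neg]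

end RealForm

/-! ### Conjugations on Lie algebras and adapted Cartan decompositions -/

section LieRealForm

variable {E : Type*} [LieRing E] [LieAlgebra ℂ E]

theorem lie_J (x y : E) : ⁅x, J E y⁆ = J E ⁅x, y⁆ := by simp

theorem J_lie (x y : E) : ⁅J E x, y⁆ = J E ⁅x, y⁆ := by simp

theorem conj_lie {g : LieSubalgebra ℝ E} (hg : IsRealForm g.toSubmodule) (z w : E) :
    conj hg ⁅z, w⁆ = ⁅conj hg z, conj hg w⁆ := by
  have h1 : ∀ x ∈ g, ∀ w, conj hg ⁅x, w⁆ = ⁅x, conj hg w⁆ := fun x hx w => by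
    obtain ⟨a, ha, b, hb, rfl⟩ := hg.exists_eq_add w
    rw [lie_add, lie_J, map_add, conj_of_mem hg (g.lie_mem hx ha),
      conj_J_of_mem hg (g.lie_mem hx hb), map_add, conj_of_mem hg ha, conj_J_of_mem hg hb,
      lie_add, lie_neg, lie_J]
  obtain ⟨x, hx, y, hy, rfl⟩ := hg.exists_eq_add z
  rw [add_lie, J_lie, map_add, conj_J, h1 x hx, h1 y hy, map_add, conj_of_mem hg hx,
    conj_J_of_mem hg hy, add_lie, neg_lie, J_lie]

variable {g u : LieSubalgebra ℝ E} {θ : g ≃ₗ⁅ℝ⁆ g}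

theorem mem_compactPart {x : E} :
    x ∈ compactPart θ ↔ ∃ h : x ∈ g, θ ⟨x, h⟩ = ⟨x, h⟩ := by
  simp [compactPart, Submodule.mem_map]

theorem mem_noncompactPart {x : E} :
    x ∈ noncompactPart θ ↔ ∃ h : x ∈ g, θ ⟨x, h⟩ = -⟨x, h⟩ := by
  simp [noncompactPart, Submodule.mem_map]

theorem IsAdapted.exists_eq_add (h : IsAdapted u θ) {x : E} (hx : x ∈ u) :
    ∃ a ∈ compactPart θ, ∃ b ∈ noncompactPart θ, x = a + J E b := by
  have hx' : x ∈ u.toSubmodule := hx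
  rw [← h] at hx'
  obtain ⟨a, ha, _, ⟨b, hb, rfl⟩, h⟩ := Submodule.mem_sup.1 hx'
  exact ⟨a, ha, b, hb, h.symm⟩

theorem IsAdapted.compactPart_le (h : IsAdapted u θ) {x : E} (hx : x ∈ compactPart θ) :
    x ∈ u := by
  have : x ∈ u.toSubmodule := by
    rw [← h]; exact Submodule.mem_sup_left hx
  exact this

theorem IsAdapted.J_noncompactPart_le (h : IsAdapted u θ) {x : E} (hx : x ∈ noncompactPart θ) :
    J E x ∈ u := by
  have : J E x ∈ u.toSubmodule := by
    rw [← h]; exact Submodule.mem_sup_right ⟨x, hx, rfl⟩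
  exact this

theorem IsAdapted.conj_mem (h : IsAdapted u θ) (hg : IsRealForm g.toSubmodule) {x : E}
    (hx : x ∈ u) : conj hg x ∈ u := by
  obtain ⟨a, ha, b, hb, rfl⟩ := h.exists_eq_add hx
  rw [map_add, conj_of_mem hg (mem_compactPart.1 ha).1,
    conj_J_of_mem hg (mem_noncompactPart.1 hb).1]
  exact u.add_mem (h.compactPart_le ha) (u.neg_mem (h.J_noncompactPart_le hb))

theorem IsAdapted.mem_compactPart_of_conj_eq (h : IsAdapted u θ) (hg : IsRealForm g.toSubmodule)
    {x : E} (hx : x ∈ u) (hc : conj hg x = x) : x ∈ compactPart θ := by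
  obtain ⟨a, ha, b, hb, rfl⟩ := h.exists_eq_add hx
  rw [map_add, conj_of_mem hg (mem_compactPart.1 ha).1,
    conj_J_of_mem hg (mem_noncompactPart.1 hb).1, add_right_inj] at hc
  rwa [eq_zero_of_eq_neg hc.symm, add_zero]

theorem IsAdapted.J_mem_noncompactPart_of_conj_eq_neg (h : IsAdapted u θ)
    (hg : IsRealForm g.toSubmodule) {x : E} (hx : x ∈ u) (hc : conj hg x = -x) :
    J E x ∈ noncompactPart θ := by
  obtain ⟨a, ha, b, hb, rfl⟩ := h.exists_eq_add hx
  rw [map_add, conj_of_mem hg (mem_compactPart.1 ha).1,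
    conj_J_of_mem hg (mem_noncompactPart.1 hb).1, neg_add, add_left_inj] at hc
  rw [eq_zero_of_eq_neg hc, zero_add, J_J]
  exact neg_mem hb

/-- The elements of `u` on which two operators act by prescribed scalars. -/
noncomputable def signSpace (u : LieSubalgebra ℝ E) (σ σ' : E →ₗ[ℝ] E) (ε δ : ℝ) :
    Submodule ℝ E :=
  u.toSubmodule ⊓ Module.End.eigenspace σ ε ⊓ Module.End.eigenspace σ' δ

theorem mem_signSpace {σ σ' : E →ₗ[ℝ] E} {ε δ : ℝ} {x : E} :
    x ∈ signSpace u σ σ' ε δ ↔ x ∈ u ∧ σ x = ε • x ∧ σ' x = δ • x := by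
  simp [signSpace, and_assoc]

/-! ### The Klein four-grading of the compact form -/

section Grading

variable {σ σ' : E →ₗ[ℝ] E}

theorem lie_mem_signSpace (hσ : ∀ x y, σ ⁅x, y⁆ = ⁅σ x, σ y⁆)
    (hσ' : ∀ x y, σ' ⁅x, y⁆ = ⁅σ' x, σ' y⁆) {a b c d e f : ℝ} {x y : E}
    (hx : x ∈ signSpace u σ σ' a b) (hy : y ∈ signSpace u σ σ' c d)
    (he : a * c = e) (hf : b * d = f) : ⁅x, y⁆ ∈ signSpace u σ σ' e f := by
  rw [mem_signSpace] at *
  refine ⟨u.lie_mem hx.1 hy.1, ?_, ?_⟩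
  · rw [hσ, hx.2.1, hy.2.1, smul_lie, lie_smul, smul_smul, he]
  · rw [hσ', hx.2.2, hy.2.2, smul_lie, lie_smul, smul_smul, hf]

theorem exists_eq_add_signSpace (hσ : ∀ x, σ (σ x) = x) (hσ' : ∀ x, σ' (σ' x) = x)
    (hcomm : ∀ x, σ (σ' x) = σ' (σ x)) (hσu : ∀ x ∈ u, σ x ∈ u) (hσu' : ∀ x ∈ u, σ' x ∈ u)
    {x : E} (hx : x ∈ u) :
    ∃ o ∈ signSpace u σ σ' 1 1, ∃ a ∈ signSpace u σ σ' 1 (-1), ∃ b ∈ signSpace u σ σ' (-1) 1,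
      ∃ c ∈ signSpace u σ σ' (-1) (-1), x = o + a + b + c := by
  -- Each component is the average over the group generated by σ and σ', weighted by the character
  -- (ε, δ).
  have key : ∀ ε δ : ℝ, ε * ε = 1 → δ * δ = 1 →
      (1 / 4 : ℝ) • (x + ε • σ x + δ • σ' x + (ε * δ) • σ (σ' x)) ∈ signSpace u σ σ' ε δ := by
    intro ε δ hε hδ
    rw [mem_signSpace]
    refine ⟨u.smul_mem _ (u.add_mem (u.add_mem (u.add_mem hx (u.smul_mem _ (hσu _ hx)))
      (u.smul_mem _ (hσu' _ hx))) (u.smul_mem _ (hσu _ (hσu' _ hx)))), ?_, ?_⟩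
    · simp only [map_add, map_smul, hσ]
      match_scalars <;> grind
    · simp only [map_add, map_smul, hσ', hcomm]
      match_scalars <;> grind
  refine ⟨_, key 1 1 ?_ ?_, _, key 1 (-1) ?_ ?_, _, key (-1) 1 ?_ ?_, _, key (-1) (-1) ?_ ?_, ?_⟩
  iterate 8 norm_num
  module

/-- If two commuting antilinear involutive automorphisms of a complex semisimple Lie algebra
preserving the compact form `u` have no common nonzero fixed vector in `u`, then they are conjugate
under an automorphism. -/
theorem exists_lieEquiv_intertwining [FiniteDimensional ℂ E] (hu : IsRealForm u.toSubmodule)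
    (hslice : IsRealSlice (-killingForm ℂ E) u.toSubmodule)
    (hpos : ∀ x ∈ u, x ≠ 0 → 0 < ((-killingForm ℂ E) x x).re)
    (hσ : ∀ x, σ (σ x) = x) (hσ' : ∀ x, σ' (σ' x) = x)
    (hcomm : ∀ x, σ (σ' x) = σ' (σ x)) (hσu : ∀ x ∈ u, σ x ∈ u) (hσu' : ∀ x ∈ u, σ' x ∈ u)
    (hlie : ∀ x y, σ ⁅x, y⁆ = ⁅σ x, σ y⁆) (hlie' : ∀ x y, σ' ⁅x, y⁆ = ⁅σ' x, σ' y⁆)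
    (hJ : ∀ x, σ (J E x) = -J E (σ x)) (hJ' : ∀ x, σ' (J E x) = -J E (σ' x))
    (hfix : signSpace u σ σ' 1 1 = ⊥) :
    ∃ φ : E ≃ₗ⁅ℝ⁆ E, ∀ z, φ (σ z) = σ' (φ z) := by
  let A := signSpace u σ σ' 1 (-1)
  let B := signSpace u σ σ' (-1) 1
  let C := signSpace u σ σ' (-1) (-1)
  have hdec : ∀ x ∈ u, ∃ a ∈ A, ∃ b ∈ B, ∃ c ∈ C, x = a + b + c := fun x hx => by
    obtain ⟨o, ho, a, ha, b, hb, c, hc, rfl⟩ :=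
      exists_eq_add_signSpace hσ hσ' hcomm hσu hσu' hx
    rw [hfix, Submodule.mem_bot] at ho
    exact ⟨a, ha, b, hb, c, hc, by rw [ho, zero_add]⟩
  have hAA : ∀ x ∈ A, ∀ y ∈ A, ⁅x, y⁆ = 0 := fun x hx y hy => by
    rw [← Submodule.mem_bot ℝ, ← hfix]
    exact lie_mem_signSpace hlie hlie' hx hy (by norm_num) (by norm_num)
  have hBB : ∀ x ∈ B, ∀ y ∈ B, ⁅x, y⁆ = 0 := fun x hx y hy => by
    rw [← Submodule.mem_bot ℝ, ← hfix]
    exact lie_mem_signSpace hlie hlie' hx hy (by norm_num) (by norm_num)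
  have hCC : ∀ x ∈ C, ∀ y ∈ C, ⁅x, y⁆ = 0 := fun x hx y hy => by
    rw [← Submodule.mem_bot ℝ, ← hfix]
    exact lie_mem_signSpace hlie hlie' hx hy (by norm_num) (by norm_num)
  have hCA : ∀ x ∈ C, ∀ y ∈ A, ⁅x, y⁆ ∈ B := fun x hx y hy =>
    lie_mem_signSpace hlie hlie' hx hy (by norm_num) (by norm_num)
  have hCB : ∀ x ∈ C, ∀ y ∈ B, ⁅x, y⁆ ∈ A := fun x hx y hy =>
    lie_mem_signSpace hlie hlie' hx hy (by norm_num) (by norm_num)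
  have hAB : ∀ x ∈ A, ∀ y ∈ B, ⁅x, y⁆ ∈ C := fun x hx y hy =>
    lie_mem_signSpace hlie hlie' hx hy (by norm_num) (by norm_num)
  have hBA : ∀ x ∈ B, ∀ y ∈ A, ⁅x, y⁆ ∈ C := fun x hx y hy =>
    lie_mem_signSpace hlie hlie' hx hy (by norm_num) (by norm_num)
  let Q : E →ₗ[ℝ] E →ₗ[ℝ] ℝ := LinearMap.mk₂ ℝ (fun x y => ((-killingForm ℂ E) x y).re)
    (fun x y z => by simp [add_comm]) (fun r x y => by simp [← Complex.coe_smul])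
    (fun x y z => by simp [add_comm]) (fun r x y => by simp [← Complex.coe_smul])
  have hQ : ∀ x y, Q x y = ((-killingForm ℂ E) x y).re := fun x y => rfl
  have hsymm : ∀ x y, Q x y = Q y x := fun x y => by
    simp only [hQ, LinearMap.neg_apply]
    rw [LieModule.traceForm_comm]
  have hinv : ∀ x y z, Q ⁅x, y⁆ z = Q x ⁅y, z⁆ := fun x y z => by
    simp only [hQ, LinearMap.neg_apply]
    rw [LieModule.traceForm_apply_lie_apply]
  have hposQ : ∀ x ∈ u, x ≠ 0 → 0 < Q x x := hpos
  have hcentral : ∀ x ∈ u, (∀ y ∈ u, ⁅y, x⁆ = 0) → x = 0 := fun x hx h => by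
    have h0 : ∀ y : E, ⁅x, y⁆ = 0 := fun y => by
      obtain ⟨a, ha, b, hb, rfl⟩ := hu.exists_eq_add y
      rw [← lie_skew, add_lie, J_lie, h a ha, h b hb]
      simp
    refine hslice.nondegenerate x hx fun y _ => ?_
    have : LieAlgebra.ad ℂ E x = 0 := LinearMap.ext h0
    rw [LinearMap.neg_apply, LinearMap.neg_apply, killingForm_apply_apply, this]
    simp
  -- For b ∈ B the bracket [b, x] lies in C, which kills x; invariance gives it norm zero. Thus x
  -- commutes with all of 𝔲.
  have hfaithA : ∀ x ∈ A, (∀ y ∈ C, ⁅y, x⁆ = 0) → x = 0 := fun x hx h => by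
    refine hcentral x (mem_signSpace.1 hx).1 fun y hy => ?_
    obtain ⟨a, ha, b, hb, c, hc, rfl⟩ := hdec y hy
    have hbx : ⁅b, x⁆ = 0 := by
      by_contra hne
      have hmem := hBA _ hb _ hx
      have := hposQ _ (mem_signSpace.1 hmem).1 hne
      rw [hinv, ← lie_skew x, h _ hmem] at this
      simp at this
    rw [add_lie, add_lie, hAA a ha x hx, hbx, h c hc, add_zero, add_zero]
  have hfaithB : ∀ x ∈ B, (∀ y ∈ C, ⁅y, x⁆ = 0) → x = 0 := fun x hx h => by
    refine hcentral x (mem_signSpace.1 hx).1 fun y hy => ?_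
    obtain ⟨a, ha, b, hb, c, hc, rfl⟩ := hdec y hy
    have hax : ⁅a, x⁆ = 0 := by
      by_contra hne
      have hmem := hAB _ ha _ hx
      have := hposQ _ (mem_signSpace.1 hmem).1 hne
      rw [hinv, ← lie_skew x, h _ hmem] at this
      simp at this
    rw [add_lie, add_lie, hBB b hb x hx, hax, h c hc, add_zero, add_zero]
  have : FiniteDimensional ℝ E := FiniteDimensional.trans ℝ ℂ E
  obtain ⟨W, hWC, hWA⟩ := exists_lie_lie_eq_neg Q hsymm hinv A B C
    (fun x hx => hposQ x (mem_signSpace.1 hx).1) (fun x hx => hposQ x (mem_signSpace.1 hx).1)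
    (fun x hx => hposQ x (mem_signSpace.1 hx).1) hAA hCC hCA hAB hCB hfaithA
  -- Every y ∈ C kills (ad W)²x + x: ad y commutes with ad W, and [y, x] lies in A, where (ad W)² =
  -- -1.
  have hWB : ∀ x ∈ B, ⁅W, ⁅W, x⁆⁆ = -x := fun x hx => by
    have hmem := hCA _ hWC _ (hCB _ hWC _ hx)
    refine eq_neg_of_add_eq_zero_left (hfaithB _ (add_mem hmem hx) fun y hy => ?_)
    have hsw : ∀ z : E, ⁅y, ⁅W, z⁆⁆ = ⁅W, ⁅y, z⁆⁆ := fun z => by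
      rw [leibniz_lie, hCC y hy W hWC, zero_lie, zero_add]
    rw [lie_add, hsw, hsw, hWA _ (hCB y hy x hx), neg_add_cancel]
  have hW3u : ∀ x ∈ u, ⁅W, ⁅W, ⁅W, x⁆⁆⁆ = -⁅W, x⁆ := fun x hx => by
    obtain ⟨a, ha, b, hb, c, hc, rfl⟩ := hdec x hx
    simp only [lie_add]
    rw [hWA a ha, hWB b hb, hCC W hWC c hc]
    simp only [lie_neg, lie_zero]
    abel
  obtain ⟨φ, hφ⟩ := exists_lieEquiv_of_derivation_cube_eq_neg (LieDerivation.ad ℝ E W) fun x => by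
    obtain ⟨a, ha, b, hb, rfl⟩ := hu.exists_eq_add x
    simp only [LieDerivation.ad_apply_apply, lie_add, lie_J]
    rw [hW3u a ha, hW3u b hb, map_neg, neg_add]
  simp only [LieDerivation.ad_apply_apply] at hφ
  -- φ is ad W on A and B and the identity on C; the σ-sign of each piece equals the σ'-sign of its
  -- image.
  have hφu : ∀ x ∈ u, φ (σ x) = σ' (φ x) := fun x hx => by
    obtain ⟨a, ha, b, hb, c, hc, rfl⟩ := hdec x hx
    have hφa : φ a = ⁅W, a⁆ := by rw [hφ, hWA a ha]; abel
    have hφb : φ b = ⁅W, b⁆ := by rw [hφ, hWB b hb]; abel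
    have hφc : φ c = c := by rw [hφ, hCC W hWC c hc]; simp
    rw [map_add σ, map_add σ, (mem_signSpace.1 ha).2.1, (mem_signSpace.1 hb).2.1,
      (mem_signSpace.1 hc).2.1]
    simp only [map_add, map_smul, hφa, hφb, hφc]
    rw [(mem_signSpace.1 (hCA W hWC a ha)).2.2, (mem_signSpace.1 (hCB W hWC b hb)).2.2,
      (mem_signSpace.1 hc).2.2]
  have hφJ : ∀ x, φ (J E x) = J E (φ x) := fun x => by
    simp only [hφ, lie_J, map_add]
  refine ⟨φ, fun z => ?_⟩
  obtain ⟨x, hx, y, hy, rfl⟩ := hu.exists_eq_add z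
  rw [map_add, map_add, map_add, map_add, hJ, hφJ, hJ', map_neg, hφJ, hφu x hx, hφu y hy]

end Grading

end LieRealForm

/-! ### Generation by the noncompact part -/

section Simple

variable {L : Type*} [LieRing L] [LieAlgebra ℝ L]

/-- A simple Lie algebra is generated by the `-1`-eigenspace of a nontrivial involutive
automorphism. -/
theorem lieSpan_neg_eigenspace_eq_top (hL : LieAlgebra.IsSimple ℝ L) (θ : L ≃ₗ⁅ℝ⁆ L)
    (hθ : ∀ x, θ (θ x) = x) {x : L} (hx0 : x ≠ 0) (hx : θ x = -x) :
    LieSubalgebra.lieSpan ℝ L {x | θ x = -x} = ⊤ := by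
  let K := LieSubalgebra.lieSpan ℝ L {x | θ x = -x}
  have hK : ∀ y, θ y = -y → y ∈ K := fun y hy => LieSubalgebra.subset_lieSpan hy
  -- Fixed vectors of θ preserve the generating eigenspace, hence normalize K by Leibniz. Since the
  -- two eigenspaces span L, K is an ideal.
  have hfix : ∀ t, θ t = t → ∀ m ∈ K, ⁅t, m⁆ ∈ K := fun t ht m hm => by
    induction hm using LieSubalgebra.lieSpan_induction with
    | mem y hy =>
      refine hK _ ?_
      rw [LieEquiv.map_lie, ht, hy, lie_neg]
    | zero => rw [lie_zero]; exact K.zero_mem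
    | add y z _ _ hy hz => rw [lie_add]; exact K.add_mem hy hz
    | smul r y _ hy => rw [lie_smul]; exact K.smul_mem r hy
    | lie y z hyK hzK hy hz =>
      rw [leibniz_lie]
      exact K.add_mem (K.lie_mem hy hzK) (K.lie_mem hyK hz)
  let I : LieIdeal ℝ L :=
    { K.toSubmodule with
      lie_mem := fun {y m} hm => by
        have hy : y = (1 / 2 : ℝ) • (y + θ y) + (1 / 2 : ℝ) • (y - θ y) := by module
        rw [hy, add_lie]
        refine K.add_mem (hfix _ ?_ m hm) (K.lie_mem (hK _ ?_) hm)
        · rw [map_smul, map_add, hθ, add_comm]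
        · rw [map_smul, map_sub, hθ, ← smul_neg, neg_sub] }
  have hxI : x ∈ I := hK x hx
  rcases hL.eq_bot_or_eq_top I with h | h
  · rw [h, LieSubmodule.mem_bot] at hxI
    exact absurd hxI hx0
  · rw [eq_top_iff]
    intro y _
    have : y ∈ I := by rw [h]; trivial
    exact this

/-- The `-1`-eigenspace of a Cartan involution of a noncompact Lie algebra is nonzero. -/
theorem IsCartanInvolution.exists_eq_neg {θ : L ≃ₗ⁅ℝ⁆ L} (hθ : IsCartanInvolution θ)
    (hL : ¬ IsCompactLie L) : ∃ x, x ≠ 0 ∧ θ x = -x := by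
  by_contra! h
  refine hL fun x hx => ?_
  have hfix : x - θ x = 0 := by
    by_contra hne
    refine h _ hne ?_
    rw [map_sub, hθ.involutive, neg_sub]
  have := hθ.pos x hx
  rw [← sub_eq_zero.1 hfix] at this
  linarith

end Simple

end CompatibleTriple

/-! ### The two intersection statements -/

open CompatibleTriple in
theorem mainTheorem7 {E : Type*} [LieRing E] [LieAlgebra ℂ E] [FiniteDimensional ℂ E]
    (g g' u : LieSubalgebra ℝ E)
    (hg : LieAlgebra.IsSemisimple ℝ g) (hg' : LieAlgebra.IsSemisimple ℝ g')
    (htriple : CompatibleTriple.IsCompatibleTriple (-killingForm ℂ E)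
      g.toSubmodule g'.toSubmodule u.toSubmodule)
    (θ : g ≃ₗ⁅ℝ⁆ g) (hθ : CompatibleTriple.IsCartanInvolution θ)
    (hθu : CompatibleTriple.IsAdapted u θ)
    (θ' : g' ≃ₗ⁅ℝ⁆ g') (hθ' : CompatibleTriple.IsCartanInvolution θ')
    (hθu' : CompatibleTriple.IsAdapted u θ')
    (hniso : IsEmpty (g ≃ₗ⁅ℝ⁆ g')) :
    CompatibleTriple.compactPart θ ⊓ CompatibleTriple.compactPart θ' ≠ ⊥ ∧
    (LieAlgebra.IsSimple ℝ g → LieAlgebra.IsSimple ℝ g' →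
      ¬ CompatibleTriple.IsCompactLie g → ¬ CompatibleTriple.IsCompactLie g' →
      CompatibleTriple.noncompactPart θ ⊓ CompatibleTriple.noncompactPart θ' ≠ ⊥) := by
  have hW := htriple.form_left
  have hW' := htriple.form_right
  have hcomm : ∀ x, conj hW (conj hW' x) = conj hW' (conj hW x) := fun x =>
    LinearMap.congr_fun htriple.compatible_left_right x
  refine ⟨fun hbot => ?_, fun hs _ hnc hnc' hbot => ?_⟩
  · have hfix : signSpace u (conj hW) (conj hW') 1 1 = ⊥ := by
      rw [eq_bot_iff, ← hbot]
      intro x hx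
      rw [mem_signSpace, one_smul] at hx
      exact ⟨hθu.mem_compactPart_of_conj_eq hW hx.1 hx.2.1,
        hθu'.mem_compactPart_of_conj_eq hW' hx.1 hx.2.2⟩
    obtain ⟨φ, hφ⟩ := exists_lieEquiv_intertwining htriple.form_compact htriple.slice_compact
      htriple.euclidean (conj_conj hW) (conj_conj hW') hcomm (fun x => hθu.conj_mem hW)
      (fun x => hθu'.conj_mem hW') (conj_lie hW) (conj_lie hW') (conj_J hW) (conj_J hW') hfix
    refine hniso.false (LieEquiv.ofSubalgebras g g' φ (LieSubalgebra.ext _ _ fun y => ?_))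
    have hmem : ∀ z, z ∈ g ↔ φ z ∈ g' := fun z => by
      have h1 : z ∈ g ↔ conj hW z = z := (conj_eq_self_iff hW).symm
      have h2 : φ z ∈ g' ↔ conj hW' (φ z) = φ z := (conj_eq_self_iff hW').symm
      rw [h1, h2, ← hφ, EquivLike.apply_eq_iff_eq]
    rw [LieSubalgebra.mem_map]
    refine ⟨?_, fun hy => ⟨φ.symm y, (hmem _).2 ?_, φ.apply_symm_apply y⟩⟩
    · rintro ⟨z, hz, rfl⟩
      exact (hmem z).1 hz
    · rwa [φ.apply_symm_apply]
  · have hneg : ∀ x ∈ u, conj hW x = -x → conj hW' x = -x → x = 0 := fun x hx h h' => by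
      have hmem : J E x ∈ noncompactPart θ ⊓ noncompactPart θ' :=
        ⟨hθu.J_mem_noncompactPart_of_conj_eq_neg hW hx h,
          hθu'.J_mem_noncompactPart_of_conj_eq_neg hW' hx h'⟩
      rw [hbot, Submodule.mem_bot] at hmem
      exact J_injective (by rw [hmem, map_zero])
    have hpp : ∀ x ∈ noncompactPart θ, ∀ y ∈ noncompactPart θ', ⁅x, y⁆ = 0 := fun x hx y hy => by
      have hxu := hθu.J_noncompactPart_le hx
      have hyu := hθu'.J_noncompactPart_le hy
      have hσx := conj_J_of_mem hW (mem_noncompactPart.1 hx).1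
      have hσy := conj_J_of_mem hW' (mem_noncompactPart.1 hy).1
      -- The difference σ'(ix) - ix has sign -1 under both conjugations, so it lies in C = 0.
      have hσx' : conj hW' (J E x) = J E x := by
        rw [← sub_eq_zero]
        refine hneg _ (u.sub_mem (hθu'.conj_mem hW' hxu) hxu) ?_ ?_
        · rw [map_sub, hcomm, hσx, map_neg]; abel
        · rw [map_sub, conj_conj, neg_sub]
      have hσy' : conj hW (J E y) = J E y := by
        rw [← sub_eq_zero]
        refine hneg _ (u.sub_mem (hθu.conj_mem hW hyu) hyu) ?_ ?_
        · rw [map_sub, conj_conj, neg_sub]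
        · rw [map_sub, ← hcomm, hσy, map_neg]; abel
      -- ix has signs (-1, 1) and iy has signs (1, -1), so their bracket lies in C = 0.
      have h0 := hneg _ (u.lie_mem hxu hyu)
        (by rw [conj_lie, hσx, hσy', neg_lie]) (by rw [conj_lie, hσx', hσy, lie_neg])
      rwa [J_lie, lie_J, J_J, neg_eq_zero] at h0
    obtain ⟨x, hx0, hx⟩ := hθ.exists_eq_neg hnc
    obtain ⟨y, hy0, hy⟩ := hθ'.exists_eq_neg hnc'
    have hyp : (y : E) ∈ noncompactPart θ' := mem_noncompactPart.2 ⟨y.2, hy⟩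
    have hgy : ∀ z : g, ⁅(z : E), (y : E)⁆ = 0 := fun z => by
      have hz : z ∈ LieSubalgebra.lieSpan ℝ g {x | θ x = -x} := by
        rw [lieSpan_neg_eigenspace_eq_top hs θ hθ.involutive hx0 hx]; trivial
      induction hz using LieSubalgebra.lieSpan_induction with
      | mem z hz => exact hpp _ (mem_noncompactPart.2 ⟨z.2, hz⟩) _ hyp
      | zero => simp
      | add a b _ _ ha hb => simp [ha, hb]
      | smul r a _ ha => simp [ha]
      | lie a b _ _ ha hb => simp [lie_lie, ha, hb]
    have hEy : LieAlgebra.ad ℂ E (y : E) = 0 := LinearMap.ext fun z => by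
      obtain ⟨a, ha, b, hb, rfl⟩ := hW.exists_eq_add z
      rw [LieAlgebra.ad_apply, ← lie_skew, add_lie, J_lie, hgy ⟨a, ha⟩, hgy ⟨b, hb⟩]
      simp
    refine hy0 (Subtype.ext (htriple.slice_right.nondegenerate y y.2 fun z _ => ?_))
    rw [LinearMap.neg_apply, LinearMap.neg_apply, killingForm_apply_apply, hEy]
    simp
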